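/- Let $(R,\mathfrak m)$ be a commutative Noetherian local ring and let $\mathfrak a\subseteq\mathfrak b$ be ideals of $R$ with $\mathfrak b\neq R$. For $R$-modules $M,N$ (not necessarily finitely generated unless said so) and $i\ge 0$, let $$H^i_{\mathfrak a}(M,N)=\varinjlim_k \operatorname{Ext}^i_R(M/\mathfrak a^kM,N)$$ be the generalized local cohomology module, let $\Gamma_{\mathfrak b}(N)=\{y\in N:\mathfrak b^k y=0\text{ for some }k\ge 0\}$, and let $\dim_R N$ be the supremum of $\dim R/\mathfrak p$ over $\mathfrak p\in\operatorname{Supp}_R N$. An $R$-module $N$ is called $\mathfrak b$-cofinite if $\operatorname{Supp}_R N\subseteq V(\mathfrak b)$ and $\operatorname{Ext}^i_R(R/\mathfrak b,N)$ is finitely generated for every $i\ge 0$. Given an $R$-module $M$, the class of $\mathfrak b$-weakly finite modules over $M$ is the largest class $\mathcal W$ of $R$-modules (the union of all classes $\mathcal W$) with the following four properties: 1. if $N\in\mathcal W$, then $\operatorname{Hom}_R(R/\mathfrak b,N)$ and $\operatorname{Hom}_R(M/\mathfrak bM,N)$ are finitely generated; 2. if $0\neq N\in\mathcal W$ and $x\in\mathfrak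 m$ is a nonzerodivisor on $N$, then $N\neq xN$, $N/xN\in\mathcal W$ and $\dim_R N/xN=\dim_R N-1$; 3. if $N\in\mathcal W$, then $\operatorname{Ass}_R(N)$ is finite; 4. if $N\in\mathcal W$, then $N/\Gamma_{\mathfrak b}(N)\in\mathcal W$. **Theorem.** Let $M$ be a finitely generated $R$-module of finite projective dimension $\operatorname{pd}_R M=d$, and let $N$ be an $R$-module which is $\mathfrak b$-weakly finite over $M$ with $\dim_R N=n<\infty$, where $d,n\geq 0$ are integers. Then $H^{d+n}_{\mathfrak a}(M,N)$ is Artinian and $\mathfrak b$-cofinite. In particular, if $\mathfrak a=\mathfrak b$, then $H^{d+n}_{\mathfrak a}(M,N)$ is Artinian and $\mathfrak a$-cofinite. -/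

import Mathlib

open CategoryTheory

universe u

namespace GenLocalCohomology

variable {R : Type u} [CommRing R]

/-- The `I`-torsion submodule `Γ_I(N)`: all `y ∈ N` with `I ^ k • y = 0` for some `k`. -/
def gammaTorsion (I : Ideal R) (N : Type u) [AddCommGroup N] [Module R N] : Submodule R N where
  carrier := {y | ∃ k : ℕ, ∀ r ∈ I ^ k, r • y = 0}
  zero_mem' := ⟨0, fun r _ => smul_zero r⟩
  add_mem' := by
    rintro y z ⟨k, hk⟩ ⟨l, hl⟩
    refine ⟨max k l, fun r hr => ?_⟩
    rw [smul_add, hk r (Ideal.pow_le_pow_right (le_max_left k l) hr),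
      hl r (Ideal.pow_le_pow_right (le_max_right k l) hr), add_zero]
  smul_mem' := by
    rintro c y ⟨k, hk⟩
    exact ⟨k, fun r hr => by rw [smul_comm, hk r hr, smul_zero]⟩

/-- The module `M / I ^ k M`, as an object of the category of `R`-modules. -/
abbrev quotPow (I : Ideal R) (M : Type u) [AddCommGroup M] [Module R M] (k : ℕ) :
    ModuleCat.{u} R :=
  ModuleCat.of R (M ⧸ (I ^ k • ⊤ : Submodule R M))

/-- The canonical projection `M / I ^ l M → M / I ^ k M` for `k ≤ l`. -/
noncomputable def quotPowMap (I : Ideal R) (M : Type u) [AddCommGroup M] [Module R M] (k l : ℕ) (h : k ≤ l) :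
    quotPow I M l ⟶ quotPow I M k :=
  ModuleCat.ofHom (Submodule.factor (Submodule.smul_mono_left (Ideal.pow_le_pow_right h)))

/-- The transition map `Ext^i(M / I ^ k M, N) → Ext^i(M / I ^ l M, N)` for `k ≤ l`, induced by the
projection `M / I ^ l M → M / I ^ k M`. -/
noncomputable def extPowMap (I : Ideal R) (i : ℕ) (M N : Type u) [AddCommGroup M] [Module R M]
    [AddCommGroup N] [Module R N] (k l : ℕ) (h : k ≤ l) :
    Abelian.Ext (quotPow I M k) (ModuleCat.of R N) i →ₗ[R]
      Abelian.Ext (quotPow I M l) (ModuleCat.of R N) i :=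
  (Abelian.Ext.mk₀ (quotPowMap I M k l h)).precompOfLinear R (ModuleCat.of R N) (zero_add i)

/-- The generalized local cohomology module `H^i_I(M, N) = colim_k Ext^i(M / I ^ k M, N)`. -/
abbrev genLocalCohomology (I : Ideal R) (i : ℕ) (M N : Type u) [AddCommGroup M] [Module R M]
    [AddCommGroup N] [Module R N] : Type u :=
  Module.DirectLimit
    (fun k : ℕ => Abelian.Ext (quotPow I M k) (ModuleCat.of R N) i) (extPowMap I i M N)

/-- An `R`-module `N` is `I`-cofinite if `Supp N ⊆ V(I)` and all `Ext^i(R / I, N)` are finitely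
generated. -/
structure IsCofinite (I : Ideal R) (N : Type u) [AddCommGroup N] [Module R N] : Prop where
  support_subset : Module.support R N ⊆ PrimeSpectrum.zeroLocus (I : Set R)
  finite_ext : ∀ i : ℕ,
    Module.Finite R (Abelian.Ext (ModuleCat.of R (R ⧸ I)) (ModuleCat.of R N) i)

open scoped Pointwise in
/-- The four closure properties, for a class `W` of modules over a local ring `R`, which define the
`I`-weakly finite modules over `M`. An element `x` is regular on `N` if multiplication by `x` is
injective on `N`; only nonunits `x` are considered. -/
structure IsWeaklyFiniteClass [IsLocalRing R] (I : Ideal R) (M : Type u) [AddCommGroup M]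
    [Module R M] (W : ModuleCat.{u} R → Prop) : Prop where
  finite_hom : ∀ N, W N →
    Module.Finite R ((R ⧸ I) →ₗ[R] N) ∧
      Module.Finite R ((M ⧸ (I • ⊤ : Submodule R M)) →ₗ[R] N)
  quot_regular : ∀ N, W N → Nontrivial N →
    ∀ x ∈ IsLocalRing.maximalIdeal R, IsSMulRegular N x →
      (x • ⊤ : Submodule R N) ≠ ⊤ ∧
        W (ModuleCat.of R (N ⧸ (x • ⊤ : Submodule R N))) ∧
          Module.supportDim R (N ⧸ (x • ⊤ : Submodule R N)) + 1 = Module.supportDim R N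
  finite_ass : ∀ N, W N → (associatedPrimes R N).Finite
  quot_torsion : ∀ N, W N → W (ModuleCat.of R (N ⧸ gammaTorsion I N))

/-- `N` is `I`-weakly finite over `M` if it lies in the largest class with the four closure
properties, that is, in the union of all such classes. -/
def IsWeaklyFinite [IsLocalRing R] (I : Ideal R) (M N : Type u) [AddCommGroup M] [Module R M]
    [AddCommGroup N] [Module R N] : Prop :=
  ∃ W : ModuleCat.{u} R → Prop, IsWeaklyFiniteClass I M W ∧ W (ModuleCat.of R N)

end GenLocalCohomology

/-! Call an Artinian module `A` good if `(0 :_A b)` is finitely generated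
(`IsArtinianWithFiniteSocle`). Goodness passes to submodules and extensions and, less obviously, to
quotients (`quotientClosed`). By dimension shifting `Ext^i(X, A)` is then good for every finitely
generated `X`. For `X = R/b` this `Ext` is killed by `b`, so it equals its own `b`-socle and is
finitely generated: a good `b`-power torsion module is `b`-cofinite. It remains to see that `H =
H^{d+n}_a(M, N)` is good, by induction on `n`.

If `n = 0`, then `N` is `m`-power torsion, weak finiteness and Melkersson's criterion make `N` good,
and `H` embeds in `Ext^d(M, N)` (`toExt_injective`, an Artin-Rees argument). If `n > 0`, replacing
`N` by `Q = N/Γ_b(N)` loses nothing in degrees above `d`. Finiteness of `Ass Q` gives a `Q`-regular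
`x ∈ b`, and the long exact sequence for multiplication by `x` puts the kernel of `x` on
`H^{d+n}_a(M, Q)` inside a quotient of `H^{d+n-1}_a(M, Q/xQ)`, good by induction.

Since `x` need not lie in `a`, torsion with respect to `a` does not show that `x` acts with power
torsion. This comes from `genLocalCohomology_vanishing`: in degree `pd M + dim N` the module is
`m`-power torsion. -/

namespace GenLocalCohomology

/-! ### Artinian modules and power torsion -/

section ArtinianModules

open Submodule

variable {R : Type*} [CommRing R]

/-- If every element of `A` is killed by a power of `x` and the kernel of multiplication by `x`
is Artinian, then `A` is Artinian. -/
theorem isArtinian_of_isArtinian_torsionBy {A : Type*} [AddCommGroup A] [Module R A] (x : R)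
    (hx : ∀ a : A, ∃ k : ℕ, x ^ k • a = 0) [IsArtinian R (torsionBy R A x)] : IsArtinian R A := by
  -- `φ k B` is `x ^ k B ∩ (0 :_A x)`. By `φ_inj` these traces, over all `k`, distinguish nested
  -- submodules.
  let φ (k : ℕ) (B : Submodule R A) : Submodule R (torsionBy R A x) :=
    (B.map (LinearMap.lsmul R A (x ^ k))).comap (torsionBy R A x).subtype
  have φ_mono (k : ℕ) {B B' : Submodule R A} (h : B ≤ B') : φ k B ≤ φ k B' :=
    Submodule.comap_mono (Submodule.map_mono h)
  have φ_anti {k l : ℕ} (h : k ≤ l) (B : Submodule R A) : φ l B ≤ φ k B := by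
    rintro t ⟨b, hb, hbt⟩
    refine ⟨x ^ (l - k) • b, B.smul_mem _ hb, ?_⟩
    rw [← hbt]
    simp [smul_smul, ← pow_add, Nat.sub_add_cancel h]
  have φ_inj {B B' : Submodule R A} (h : B ≤ B') (hφ : ∀ k, φ k B' ≤ φ k B) : B' ≤ B := by
    have key : ∀ k : ℕ, ∀ b ∈ B', x ^ k • b = 0 → b ∈ B := by
      intro k
      induction k with
      | zero => intro b _ hb; simp_all
      | succ k ih =>
        intro b hb hbk
        have hmem : (⟨x ^ k • b, by simpa [smul_smul, ← pow_succ'] using hbk⟩ :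
            torsionBy R A x) ∈ φ k B' := ⟨b, hb, rfl⟩
        obtain ⟨c, hc, hcb⟩ := hφ k hmem
        have hcb' : x ^ k • c = x ^ k • b := hcb
        have := ih (b - c) (B'.sub_mem hb (h hc)) (by rw [smul_sub, hcb', sub_self])
        simpa using B.add_mem this hc
    intro b hb
    obtain ⟨k, hk⟩ := hx b
    exact key k b hb hk
  rw [← monotone_stabilizes_iff_artinian]
  intro f
  -- The diagonal `φ i (f i)` stabilizes at some `n`, which handles all `k ≥ n` at once; the
  -- finitely many `k < n` are stabilized one by one.
  have hf {i j : ℕ} (h : i ≤ j) : OrderDual.ofDual (f j) ≤ OrderDual.ofDual (f i) := f.monotone h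
  obtain ⟨n, hn⟩ := monotone_stabilizes_iff_artinian.mpr
    (inferInstance : IsArtinian R (torsionBy R A x))
    ⟨fun i => OrderDual.toDual (φ i (OrderDual.ofDual (f i))), fun i j h =>
      (φ_mono j (hf h)).trans (φ_anti h _)⟩
  have hk (k : ℕ) : ∃ m, ∀ i ≥ m, φ k (OrderDual.ofDual (f m)) = φ k (OrderDual.ofDual (f i)) :=
    monotone_stabilizes_iff_artinian.mpr
      (inferInstance : IsArtinian R (torsionBy R A x))
      ⟨fun i => OrderDual.toDual (φ k (OrderDual.ofDual (f i))), fun i j h => φ_mono k (hf h)⟩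
  choose m hm using hk
  let M := n + (Finset.range n).sup m
  refine ⟨M, fun j hj => ?_⟩
  refine le_antisymm (f.monotone hj) (φ_inj (hf hj) fun k => ?_)
  by_cases hkn : k < n
  · have h1 : m k ≤ M := (Finset.le_sup (f := m) (Finset.mem_range.mpr hkn)).trans (by omega)
    exact ((hm k M h1).symm.trans (hm k j (h1.trans hj))).le
  · push Not at hkn
    have e1 : φ n (OrderDual.ofDual (f n)) =
      φ (max k j) (OrderDual.ofDual (f (max k j))) := hn (max k j) (by omega)
    calc φ k (OrderDual.ofDual (f M)) ≤ φ n (OrderDual.ofDual (f n)) :=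
          (φ_mono k (hf (by omega))).trans (φ_anti hkn _)
      _ = φ (max k j) (OrderDual.ofDual (f (max k j))) := e1
      _ ≤ _ := (φ_mono _ (hf (le_max_right k j))).trans (φ_anti (le_max_left k j) _)

/-- Melkersson's criterion. -/
theorem isArtinian_of_isArtinian_torsionBySet (s : Finset R) {A : Type*} [AddCommGroup A]
    [Module R A] (hs : ∀ x ∈ s, ∀ a : A, ∃ k : ℕ, x ^ k • a = 0)
    (h : IsArtinian R (torsionBySet R A (s : Set R))) : IsArtinian R A := by
  classical
  induction s using Finset.induction_on generalizing A with
  | empty =>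
    refine isArtinian_of_injective
      ((LinearMap.id : A →ₗ[R] A).codRestrict (torsionBySet R A ((∅ : Finset R) : Set R))
        (fun a => ?_)) fun a b hab => congrArg Subtype.val hab
    rw [mem_torsionBySet_iff]
    rintro ⟨r, hr⟩
    simp at hr
  | insert x s hxs ih =>
    have : IsArtinian R (torsionBy R A x) := by
      refine ih (fun y hy a => ?_) ?_
      · obtain ⟨k, hk⟩ := hs y (Finset.mem_insert_of_mem hy) a
        exact ⟨k, Subtype.ext hk⟩
      · refine isArtinian_of_injective
          (((torsionBy R A x).subtype ∘ₗ (torsionBySet R (torsionBy R A x) (s : Set R)).subtype).codRestrict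
            (torsionBySet R A ((insert x s : Finset R) : Set R)) (fun a => ?_)) fun a b hab => ?_
        · rw [mem_torsionBySet_iff]
          rintro ⟨r, hr⟩
          rcases Finset.mem_insert.mp hr with rfl | hr
          · exact (a : torsionBy R A r).2
          · exact congrArg Subtype.val ((mem_torsionBySet_iff _ _).mp a.2 ⟨r, hr⟩)
        · exact Subtype.ext (Subtype.ext (Subtype.ext_iff.mp hab :))
    exact isArtinian_of_isArtinian_torsionBy x (hs x (Finset.mem_insert_self x s))

/-- Every element of `A` is killed by a power of `I`. -/
def IsPowTorsion (I : Ideal R) (A : Type*) [AddCommGroup A] [Module R A] : Prop :=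
  ∀ a : A, ∃ k : ℕ, ∀ r ∈ I ^ k, r • a = 0

namespace IsPowTorsion

variable {I : Ideal R} {A B : Type*} [AddCommGroup A] [Module R A] [AddCommGroup B] [Module R B]

theorem of_injective (f : A →ₗ[R] B) (hf : Function.Injective f) (h : IsPowTorsion I B) :
    IsPowTorsion I A := fun a => by
  obtain ⟨k, hk⟩ := h (f a)
  exact ⟨k, fun r hr => hf (by rw [map_smul, hk r hr, map_zero])⟩

theorem of_surjective (f : A →ₗ[R] B) (hf : Function.Surjective f) (h : IsPowTorsion I A) :
    IsPowTorsion I B := fun b => by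
  obtain ⟨a, rfl⟩ := hf b
  obtain ⟨k, hk⟩ := h a
  exact ⟨k, fun r hr => by rw [← map_smul, hk r hr, map_zero]⟩

theorem mono {J : Ideal R} (hIJ : I ≤ J) (h : IsPowTorsion J A) : IsPowTorsion I A := fun a => by
  obtain ⟨k, hk⟩ := h a
  exact ⟨k, fun r hr => hk r (Ideal.pow_right_mono hIJ k hr)⟩

theorem exists_pow_of_fg (h : IsPowTorsion I A) {N : Submodule R A} (hN : N.FG) :
    ∃ k : ℕ, ∀ r ∈ I ^ k, ∀ a ∈ N, r • a = 0 := by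
  induction N, hN using Submodule.fg_induction with
  | singleton a =>
    obtain ⟨k, hk⟩ := h a
    refine ⟨k, fun r hr b hb => ?_⟩
    obtain ⟨c, rfl⟩ := mem_span_singleton.mp hb
    rw [smul_comm, hk r hr, smul_zero]
  | sup N₁ N₂ _ _ h₁ h₂ =>
    obtain ⟨k, hk⟩ := h₁
    obtain ⟨l, hl⟩ := h₂
    refine ⟨max k l, fun r hr b hb => ?_⟩
    obtain ⟨c, hc, d, hd, rfl⟩ := mem_sup.mp hb
    rw [smul_add, hk r (Ideal.pow_le_pow_right (le_max_left k l) hr) c hc,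
      hl r (Ideal.pow_le_pow_right (le_max_right k l) hr) d hd, add_zero]

/-- If multiplication by powers of `x` kills every element and the kernel of multiplication by `x`
is `I`-power torsion, so is the module. -/
theorem of_torsionBy [IsNoetherianRing R] {x : R} (hx : ∀ a : A, ∃ k : ℕ, x ^ k • a = 0)
    (h : ∀ a : A, x • a = 0 → ∃ k : ℕ, ∀ r ∈ I ^ k, r • a = 0) : IsPowTorsion I A := by
  have key : ∀ n : ℕ, ∀ a : A, x ^ n • a = 0 → ∃ k : ℕ, ∀ r ∈ I ^ k, r • a = 0 := by
    intro n
    induction n with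
    | zero => intro a ha; exact ⟨0, fun r _ => by simp_all⟩
    | succ n ih =>
      intro a ha
      obtain ⟨k, hk⟩ := ih (x • a) (by rwa [smul_smul, ← pow_succ])
      have htors : IsPowTorsion I (torsionBy R A x) := fun t => by
        obtain ⟨l, hl⟩ := h t.1 t.2
        exact ⟨l, fun r hr => Subtype.ext (hl r hr)⟩
      -- `I ^ k a` is a finitely generated submodule of `(0 :_A x)`, so a single power `I ^ l` kills
      -- it.
      let g : ↥(I ^ k) →ₗ[R] torsionBy R A x :=
        ((LinearMap.toSpanSingleton R A a) ∘ₗ (I ^ k).subtype).codRestrict _ fun r => by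
          simpa [smul_smul, mul_comm] using hk r r.2
      obtain ⟨l, hl⟩ := htors.exists_pow_of_fg (N := LinearMap.range g)
        (LinearMap.range_eq_map g ▸ Module.Finite.fg_top.map g)
      refine ⟨l + k, fun r hr => ?_⟩
      rw [pow_add] at hr
      induction hr using Submodule.mul_induction_on' with
      | mem_mul_mem r hr s hs =>
        have := congrArg Subtype.val (hl r hr (g ⟨s, hs⟩) ⟨_, rfl⟩)
        simpa [g, smul_smul] using this
      | add r _ s _ hr hs => rw [add_smul, hr, hs, add_zero]
  intro a
  obtain ⟨n, hn⟩ := hx a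
  exact key n a hn

end IsPowTorsion

/-! ### Finitely generated socles and their passage to quotients -/

/-- Artinian modules in which the annihilator submodule `(0 :_A I)` is finitely generated. -/
structure IsArtinianWithFiniteSocle (I : Ideal R) (A : Type*) [AddCommGroup A] [Module R A] :
    Prop where
  isArtinian : IsArtinian R A
  finite : Module.Finite R (torsionBySet R A (I : Set R))

namespace IsArtinianWithFiniteSocle

variable [IsNoetherianRing R] {I : Ideal R} {A B : Type*} [AddCommGroup A] [Module R A]
  [AddCommGroup B] [Module R B]

theorem of_injective (f : A →ₗ[R] B) (hf : Function.Injective f)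
    (h : IsArtinianWithFiniteSocle I B) : IsArtinianWithFiniteSocle I A := by
  have := h.isArtinian
  have := h.finite
  refine ⟨isArtinian_of_injective f hf, Module.Finite.of_injective
    (f.restrict (p := torsionBySet R A (I : Set R)) (q := torsionBySet R B (I : Set R))
      fun a ha => ?_) fun a b hab => Subtype.ext (hf (congrArg Subtype.val hab))⟩
  rw [mem_torsionBySet_iff] at ha ⊢
  intro r
  rw [← map_smul, ha r, map_zero]

theorem of_ker (f : A →ₗ[R] B) (hker : IsArtinianWithFiniteSocle I (LinearMap.ker f))
    (h : IsArtinianWithFiniteSocle I B) : IsArtinianWithFiniteSocle I A := by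
  have := h.isArtinian
  have := h.finite
  have := hker.isArtinian
  have := hker.finite
  refine ⟨isArtinian_of_range_eq_ker (LinearMap.ker f).subtype f (by simp), ?_⟩
  rw [Module.Finite.iff_fg]
  refine Submodule.fg_of_fg_map_of_fg_inf_ker f ?_ ?_
  · refine Submodule.FG.of_le (Module.Finite.iff_fg.mp
      (inferInstance : Module.Finite R (torsionBySet R B (I : Set R)))) ?_
    rintro _ ⟨a, ha, rfl⟩
    rw [SetLike.mem_coe, mem_torsionBySet_iff] at ha
    rw [mem_torsionBySet_iff]
    intro r
    rw [← map_smul, ha r, map_zero]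
  · refine Submodule.FG.of_le ((Module.Finite.iff_fg.mp
      (inferInstance : Module.Finite R (torsionBySet R (LinearMap.ker f) (I : Set R)))).map
        (LinearMap.ker f).subtype) ?_
    rintro a ⟨ha, hk⟩
    refine ⟨⟨a, hk⟩, ?_, rfl⟩
    rw [SetLike.mem_coe, mem_torsionBySet_iff] at ha ⊢
    exact fun r => Subtype.ext (ha r)

theorem torsionBy_left {x : R} {J : Ideal R} (h : IsArtinianWithFiniteSocle (Ideal.span {x} ⊔ J) A) :
    IsArtinianWithFiniteSocle J (torsionBy R A x) := by
  have := h.isArtinian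
  have := h.finite
  refine ⟨inferInstance, Module.Finite.of_injective
    (((torsionBy R A x).subtype ∘ₗ (torsionBySet R _ (J : Set R)).subtype).codRestrict
      (torsionBySet R A ((Ideal.span {x} ⊔ J : Ideal R) : Set R)) fun a => ?_)
      fun a b hab => Subtype.ext (Subtype.ext (Subtype.ext_iff.mp hab :))⟩
  rw [mem_torsionBySet_iff]
  rintro ⟨r, hr⟩
  obtain ⟨y, hy, z, hz, rfl⟩ := mem_sup.mp hr
  obtain ⟨c, rfl⟩ := mem_span_singleton.mp hy
  have h1 : x • (a : A) = 0 := (a : torsionBy R A x).2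
  have h2 : z • (a : A) = 0 := congrArg Subtype.val ((mem_torsionBySet_iff _ _).mp a.2 ⟨z, hz⟩)
  change (c • x + z) • (a : A) = 0
  rw [add_smul, h2, smul_assoc, h1, smul_zero, add_zero]

theorem of_torsionBy {x : R} {J : Ideal R} [IsArtinian R A] (hx : x ∈ I) (hJ : J ≤ I)
    (h : IsArtinianWithFiniteSocle J (Submodule.torsionBy R A x)) :
    IsArtinianWithFiniteSocle I A := by
  have := h.finite
  refine ⟨inferInstance, Module.Finite.of_injective
    (((torsionBySet R A (I : Set R)).subtype.codRestrict (Submodule.torsionBy R A x)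
      fun a => ?_).codRestrict (torsionBySet R _ (J : Set R)) fun a => ?_)
      fun a b hab => Subtype.ext (congrArg (fun t => t.1.1) hab)⟩
  · exact (mem_torsionBySet_iff _ _).mp a.2 ⟨x, hx⟩
  · rw [mem_torsionBySet_iff]
    exact fun r => Subtype.ext ((mem_torsionBySet_iff _ _).mp a.2 ⟨r, hJ r.2⟩)

/-- Multiplication by `x` maps `(0 : x ^ (k + 1))` to `(0 : x ^ k)` with kernel inside `(0 : x)`. -/
theorem torsionBy_pow {x : R} {J : Ideal R}
    (h : IsArtinianWithFiniteSocle J (Submodule.torsionBy R A x)) (k : ℕ) :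
    IsArtinianWithFiniteSocle J (Submodule.torsionBy R A (x ^ k)) := by
  induction k with
  | zero =>
    have : Subsingleton (Submodule.torsionBy R A (x ^ 0)) :=
      ⟨fun a b => Subtype.ext (by
        have ha := a.2
        have hb := b.2
        simp only [pow_zero, mem_torsionBy_iff, one_smul] at ha hb
        rw [ha, hb])⟩
    exact of_injective (0 : _ →ₗ[R] Submodule.torsionBy R A x) (Function.injective_of_subsingleton _) h
  | succ k ih =>
    let f : Submodule.torsionBy R A (x ^ (k + 1)) →ₗ[R] Submodule.torsionBy R A (x ^ k) :=
      (LinearMap.lsmul R A x).restrict fun a ha => by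
        simpa [smul_smul, ← pow_succ] using ha
    refine of_ker f (of_injective (((Submodule.torsionBy R A (x ^ (k + 1))).subtype ∘ₗ
      (LinearMap.ker f).subtype).codRestrict (Submodule.torsionBy R A x) fun a => ?_) ?_ h) ih
    · exact congrArg Subtype.val (LinearMap.mem_ker.mp a.2)
    · exact fun a b hab => Subtype.ext (Subtype.ext (Subtype.ext_iff.mp hab :))

end IsArtinianWithFiniteSocle

/-- The class of Artinian modules with finitely generated `(0 :_A I)` is closed under quotients. -/
def QuotientClosed (I : Ideal R) : Prop :=
  ∀ ⦃A B : Type u⦄ [AddCommGroup A] [Module R A] [AddCommGroup B] [Module R B] (f : A →ₗ[R] B),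
    Function.Surjective f → IsArtinianWithFiniteSocle I A → IsArtinianWithFiniteSocle I B

variable [IsNoetherianRing R]

theorem quotientClosed_bot : QuotientClosed.{u} (⊥ : Ideal R) := by
  intro A B _ _ _ _ f hf h
  have := h.isArtinian
  have := h.finite
  have htop : torsionBySet R A ((⊥ : Ideal R) : Set R) = ⊤ := by
    ext a; simp
  have : Module.Finite R A := by
    rw [Module.finite_def, ← htop]; exact Module.Finite.iff_fg.mp h.finite
  have := Module.Finite.of_surjective f hf
  exact ⟨isArtinian_of_surjective _ f hf, inferInstance⟩

/-- Adds one generator of the ideal. For `0 → B → A → C → 0` the snake lemma gives an exact sequence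
`(0 :_A x) → (0 :_C x) → B/xB`. Both outer terms have the property for `J`, hence so does the middle
one, and the socle of `C` for `(x) + J` lies in the `J`-socle of `(0 :_C x)`. -/
theorem quotientClosed_span_sup {J : Ideal R} (hJ : QuotientClosed.{u} J) (x : R) :
    QuotientClosed.{u} (Ideal.span {x} ⊔ J) := by
  intro A C _ _ _ _ f hf h
  have := h.isArtinian
  have := isArtinian_of_surjective _ f hf
  let B := LinearMap.ker f
  have hB : IsArtinianWithFiniteSocle (Ideal.span {x} ⊔ J) B :=
    h.of_injective B.subtype B.injective_subtype
  let xB : Submodule R B := LinearMap.range (LinearMap.lsmul R B x)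
  have hBx : IsArtinianWithFiniteSocle J (B ⧸ xB) := by
    -- Once the images of powers of `x` are stable, `B = (0 :_B x ^ (k + 1)) + x ^ (k + 1) B`, so
    -- `(0 :_B x ^ (k + 1))` maps onto `B/xB`. The exponent `k + 1` ensures at least one factor `x`.
    obtain ⟨k, hk⟩ := IsArtinian.range_smul_pow_stabilizes (M := B) x
    refine hJ (xB.mkQ ∘ₗ (torsionBy R B (x ^ (k + 1))).subtype) ?_ (hB.torsionBy_left.torsionBy_pow (k + 1))
    intro c
    obtain ⟨b, rfl⟩ := xB.mkQ_surjective c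
    have hmem : x ^ (k + 1) • b ∈ LinearMap.range (x ^ (2 * (k + 1)) • LinearMap.id : B →ₗ[R] B) := by
      rw [← hk _ (by omega), hk (k + 1) (by omega)]
      exact ⟨b, rfl⟩
    obtain ⟨c, hc⟩ := hmem
    refine ⟨⟨b - x ^ (k + 1) • c, ?_⟩, ?_⟩
    · have hc' : x ^ (2 * (k + 1)) • c = x ^ (k + 1) • b := hc
      rw [mem_torsionBy_iff, smul_sub, smul_smul, ← pow_add, ← two_mul, hc', sub_self]
    · change xB.mkQ (b - x ^ (k + 1) • c) = xB.mkQ b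
      rw [map_sub, sub_eq_self, mkQ_apply, Quotient.mk_eq_zero]
      exact ⟨x ^ k • c, by simp [smul_smul, pow_succ, mul_comm]⟩
  -- `D` is the preimage of `(0 :_C x)`, so `D/B` stands for `(0 :_C x)`, and `g` induces the
  -- connecting map to `B/xB`.
  let D : Submodule R A := B.comap (LinearMap.lsmul R A x)
  let g : D →ₗ[R] B ⧸ xB := xB.mkQ ∘ₗ (LinearMap.lsmul R A x).restrict (p := D) (q := B) fun a ha => ha
  let B' : Submodule R D := B.comap D.subtype
  have hBg : B' ≤ LinearMap.ker g := by
    intro a ha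
    rw [LinearMap.mem_ker]
    refine (Quotient.mk_eq_zero xB).mpr ⟨⟨a.1, ha⟩, Subtype.ext rfl⟩
  have hDB : IsArtinianWithFiniteSocle J (D ⧸ B') := by
    refine IsArtinianWithFiniteSocle.of_ker (B'.liftQ g hBg) ?_ hBx
    -- If `x a = x b` with `b ∈ B`, then `a - b ∈ (0 :_A x)` has the same class as `a`; so `(0 :_A
    -- x)` covers the kernel.
    refine hJ ((B'.mkQ ∘ₗ (torsionBy R A x).subtype.codRestrict D fun a => ?_).codRestrict _
      fun a => ?_) ?_ h.torsionBy_left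
    · change x • (a : A) ∈ B
      rw [(mem_torsionBy_iff _ _).mp a.2]
      exact B.zero_mem
    · rw [LinearMap.mem_ker, LinearMap.comp_apply, mkQ_apply, liftQ_apply]
      refine (Quotient.mk_eq_zero xB).mpr ?_
      have h0 : x • (a : A) = 0 := a.2
      convert xB.zero_mem using 1
      exact Subtype.ext h0
    · rintro ⟨c, hc⟩
      obtain ⟨a, rfl⟩ := B'.mkQ_surjective c
      rw [LinearMap.mem_ker, mkQ_apply, liftQ_apply] at hc
      obtain ⟨b, hb⟩ := (Quotient.mk_eq_zero xB).mp hc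
      have hb' : x • (b : A) = x • (a : A) := congrArg Subtype.val hb
      refine ⟨⟨a - b, by rw [mem_torsionBy_iff, smul_sub, hb', sub_self]⟩, Subtype.ext ?_⟩
      refine (Submodule.Quotient.eq B').mpr ?_
      change (a : A) - b - a ∈ B
      simp
  refine IsArtinianWithFiniteSocle.of_torsionBy (x := x) (J := J)
    (le_sup_left (a := Ideal.span {x}) (Ideal.mem_span_singleton_self x)) le_sup_right
    (hJ (B'.liftQ ((f ∘ₗ D.subtype).codRestrict (torsionBy R C x) fun a => ?_) ?_) ?_ hDB)
  · rw [mem_torsionBy_iff]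
    have ha : f (x • (a : A)) = 0 := a.2
    simpa using ha
  · intro a ha
    exact Subtype.ext ha
  · rintro ⟨c, hc⟩
    obtain ⟨a, rfl⟩ := hf c
    refine ⟨B'.mkQ ⟨a, ?_⟩, rfl⟩
    change f (x • a) = 0
    rw [map_smul]
    exact hc

theorem quotientClosed (I : Ideal R) : QuotientClosed.{u} I := by
  classical
  obtain ⟨s, rfl⟩ := IsNoetherian.noetherian I
  induction s using Finset.induction_on with
  | empty => simpa using quotientClosed_bot
  | insert x s _ ih =>
    rw [Finset.coe_insert, Submodule.span_insert]
    exact quotientClosed_span_sup ih x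

/-- `(0 :_A m)` lies in `(0 :_A I)`, hence is a finite-dimensional vector space over the residue
field; Melkersson's criterion applies to generators of `m`. -/
theorem IsArtinianWithFiniteSocle.of_isPowTorsion [IsLocalRing R] {I : Ideal R}
    (hI : I ≤ IsLocalRing.maximalIdeal R) {A : Type*} [AddCommGroup A] [Module R A]
    (hA : IsPowTorsion (IsLocalRing.maximalIdeal R) A)
    (h : Module.Finite R (torsionBySet R A (I : Set R))) : IsArtinianWithFiniteSocle I A := by
  refine ⟨?_, h⟩
  obtain ⟨s, hs⟩ := IsNoetherian.noetherian (IsLocalRing.maximalIdeal R)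
  refine isArtinian_of_isArtinian_torsionBySet s (fun x hx a => ?_) ?_
  · obtain ⟨k, hk⟩ := hA a
    exact ⟨k, hk _ (Ideal.pow_mem_pow (hs ▸ subset_span hx) k)⟩
  · rw [torsionBySet_eq_torsionBySet_span, show Ideal.span (s : Set R) = _ from hs]
    have hle : torsionBySet R A (IsLocalRing.maximalIdeal R : Set R) ≤
        torsionBySet R A (I : Set R) := torsionBySet_le_torsionBySet_of_subset hI
    have : Module.Finite R (torsionBySet R A (IsLocalRing.maximalIdeal R : Set R)) :=
      Module.Finite.of_injective _ (inclusion_injective hle)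
    let := (torsionBySet_isTorsionBySet (R := R) (M := A)
      (IsLocalRing.maximalIdeal R : Set R)).module
    have : Module.Finite (R ⧸ IsLocalRing.maximalIdeal R)
      (torsionBySet R A (IsLocalRing.maximalIdeal R : Set R)) :=
        Module.Finite.of_restrictScalars_finite R _ _
    let := Ideal.Quotient.field (IsLocalRing.maximalIdeal R)
    have : IsArtinian (R ⧸ IsLocalRing.maximalIdeal R)
      (torsionBySet R A (IsLocalRing.maximalIdeal R : Set R)) := inferInstance
    exact (isArtinian_of_surjective_algebraMap (S := R) (R := R ⧸ IsLocalRing.maximalIdeal R)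
      Ideal.Quotient.mk_surjective)

end ArtinianModules

/-! ### Ext with a finitely generated first argument -/

section Ext

open Abelian

variable {R : Type u} [CommRing R]

theorem ext_smul_eq_zero_left {X Y : ModuleCat.{u} R} {i : ℕ} (r : R) (hr : ∀ x : X, r • x = 0)
    (e : Ext X Y i) : r • e = 0 := by
  have h : r • 𝟙 X = 0 := by
    ext x
    exact hr x
  calc r • e = (r • Ext.mk₀ (𝟙 X)).comp e (zero_add i) := by simp
    _ = 0 := by rw [← Ext.mk₀_smul, h, Ext.mk₀_zero, Ext.zero_comp]

theorem ext_smul_eq_zero_right {X Y : ModuleCat.{u} R} {i : ℕ} (r : R) (hr : ∀ y : Y, r • y = 0)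
    (e : Ext X Y i) : r • e = 0 := by
  have h : r • 𝟙 Y = 0 := by
    ext y
    exact hr y
  rw [Ext.smul_eq_comp_mk₀, h, Ext.mk₀_zero, Ext.comp_zero]

variable [IsNoetherianRing R]

/-- Every class in `Ext^i(X, N)`, with `X` finitely generated, comes from a finitely generated
submodule of `N`. -/
theorem exists_fg_ext_comp_subtype (X : ModuleCat.{u} R) [Module.Finite R X]
    (N : Type u) [AddCommGroup N] [Module R N] (i : ℕ) (e : Ext X (ModuleCat.of R N) i) :
    ∃ N' : Submodule R N, N'.FG ∧ ∃ e' : Ext X (ModuleCat.of R N') i,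
      e'.comp (Ext.mk₀ (ModuleCat.ofHom N'.subtype)) (add_zero i) = e := by
  induction i generalizing X with
  | zero =>
    obtain ⟨f, rfl⟩ := Ext.mk₀_bijective _ _ |>.2 e
    refine ⟨LinearMap.range f.hom, LinearMap.range_eq_map f.hom ▸ Module.Finite.fg_top.map f.hom,
      Ext.mk₀ (ModuleCat.ofHom f.hom.rangeRestrict), ?_⟩
    rw [Ext.mk₀_comp_mk₀]
    rfl
  | succ i ih =>
    obtain ⟨F, _, _, _, _, p, hp⟩ := Module.exists_finite_presentation R X
    have hS := LinearMap.shortExact_shortComplexKer hp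
    obtain ⟨η, rfl⟩ := Ext.contravariant_sequence_exact₃ hS _ e
      (Ext.eq_zero_of_projective _) (add_comm 1 i)
    obtain ⟨N', hN', η', rfl⟩ := ih (ModuleCat.of R (LinearMap.ker p)) η
    refine ⟨N', hN', hS.extClass.comp η' (add_comm 1 i), ?_⟩
    exact Ext.comp_assoc _ _ _ _ _ (by omega)

/-- A class in `Ext^i(X, T)`, with `X` finitely generated and `T` an `I`-power torsion module,
restricts to zero along every map with image in `I ^ s X`, for `s` large enough. -/
theorem exists_pow_comp_eq_zero (I : Ideal R) (X : ModuleCat.{u} R) [Module.Finite R X]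
    (T : Type u) [AddCommGroup T] [Module R T] (hT : IsPowTorsion I T) (i : ℕ)
    (e : Ext X (ModuleCat.of R T) i) :
    ∃ s : ℕ, ∀ (Y : ModuleCat.{u} R) (f : Y ⟶ X),
      LinearMap.range f.hom ≤ I ^ s • (⊤ : Submodule R X) →
        (Ext.mk₀ f).comp e (zero_add i) = 0 := by
  induction i generalizing X with
  | zero =>
    obtain ⟨g, rfl⟩ := Ext.mk₀_bijective _ _ |>.2 e
    obtain ⟨s, hs⟩ := hT.exists_pow_of_fg (N := LinearMap.range g.hom)
      (LinearMap.range_eq_map g.hom ▸ Module.Finite.fg_top.map g.hom)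
    refine ⟨s, fun Y f hf => ?_⟩
    have hle : I ^ s • (⊤ : Submodule R X) ≤ LinearMap.ker g.hom := by
      rw [Submodule.smul_le]
      intro r hr x _
      rw [LinearMap.mem_ker, map_smul]
      exact hs r hr _ ⟨x, rfl⟩
    have h : f ≫ g = 0 := by
      ext y
      exact hle (hf ⟨y, rfl⟩)
    rw [Ext.mk₀_comp_mk₀, h, Ext.mk₀_zero]
  | succ i ih =>
    obtain ⟨F, _, _, _, _, p, hp⟩ := Module.exists_finite_presentation R X
    have hS := LinearMap.shortExact_shortComplexKer hp
    obtain ⟨η, rfl⟩ := Ext.contravariant_sequence_exact₃ hS _ e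
      (Ext.eq_zero_of_projective _) (add_comm 1 i)
    obtain ⟨s, hs⟩ := ih (ModuleCat.of R (LinearMap.ker p)) η
    -- Artin-Rees: `I ^ (s + c) F ∩ ker p = I ^ s (I ^ c F ∩ ker p) ⊆ I ^ s ker p`.
    obtain ⟨c, hc⟩ := Ideal.exists_pow_inf_eq_pow_smul I (LinearMap.ker p)
    refine ⟨s + c, fun Y f hf => ?_⟩
    -- The pullback of `f` along `p`, with the `F`-component restricted to `I ^ (s + c) F`. It still
    -- surjects onto `Y`, and the kernel of that surjection maps into `I ^ s ker p`, where the
    -- induction hypothesis kills `η`.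
    let P : Submodule R (F × Y) :=
      (I ^ (s + c) • (⊤ : Submodule R F)).comap (LinearMap.fst R F Y) ⊓
        LinearMap.ker (p.coprod (-f.hom))
    have hP (z : P) : z.1.1 ∈ I ^ (s + c) • (⊤ : Submodule R F) ∧ p z.1.1 = f.hom z.1.2 := by
      refine ⟨z.2.1, ?_⟩
      have := z.2.2
      simpa [sub_eq_zero, ← sub_eq_add_neg] using this
    let q : P →ₗ[R] Y := LinearMap.snd R F Y ∘ₗ P.subtype
    have hq : Function.Surjective q := by
      intro y
      have hy := hf ⟨y, rfl⟩
      have hmap : (I ^ (s + c) • (⊤ : Submodule R F)).map p = I ^ (s + c) • (⊤ : Submodule R X) := by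
        rw [Submodule.map_smul'', Submodule.map_top, LinearMap.range_eq_top.mpr hp]
      rw [← hmap] at hy
      obtain ⟨u, hu, huy⟩ := hy
      exact ⟨⟨(u, y), hu, by simp [huy]⟩, rfl⟩
    have hS' := LinearMap.shortExact_shortComplexKer hq
    have hker (z : LinearMap.ker q) : p z.1.1.1 = 0 := by
      have hz : z.1.1.2 = 0 := z.2
      rw [(hP z.1).2, hz, map_zero]
    let t : LinearMap.ker q →ₗ[R] LinearMap.ker p :=
      (LinearMap.fst R F Y ∘ₗ P.subtype ∘ₗ (LinearMap.ker q).subtype).codRestrict _ hker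
    let φ : q.shortComplexKer ⟶ p.shortComplexKer :=
      { τ₁ := ModuleCat.ofHom (X := LinearMap.ker q) (Y := LinearMap.ker p) t
        τ₂ := ModuleCat.ofHom (LinearMap.fst R F Y ∘ₗ P.subtype)
        τ₃ := f
        comm₁₂ := rfl
        comm₂₃ := by
          ext z
          exact (hP z).2 }
    have hnat := hS'.extClass_naturality hS φ
    have ht : (Ext.mk₀ (ModuleCat.ofHom (X := LinearMap.ker q) (Y := LinearMap.ker p) t)).comp η (zero_add i) = 0 := by
      refine hs _ _ ?_
      rintro _ ⟨z, rfl⟩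
      have hmem : (t z : F) ∈ I ^ (s + c) • (⊤ : Submodule R F) ⊓ LinearMap.ker p :=
        ⟨(hP z.1).1, (t z).2⟩
      rw [hc (s + c) (by omega), Nat.add_sub_cancel] at hmem
      have hle : I ^ s • (I ^ c • (⊤ : Submodule R F) ⊓ LinearMap.ker p) ≤
          (I ^ s • (⊤ : Submodule R (LinearMap.ker p))).map (LinearMap.ker p).subtype := by
        rw [Submodule.map_smul'', Submodule.map_subtype_top]
        exact Submodule.smul_mono le_rfl inf_le_right
      have hmem' := hle hmem
      obtain ⟨w, hw, hwz⟩ := hmem'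
      have : w = t z := Subtype.ext hwz
      exact this ▸ hw
    have h1 : (Ext.mk₀ f).comp (hS.extClass.comp η (add_comm 1 i)) (zero_add (i + 1)) =
        ((Ext.mk₀ f).comp hS.extClass (zero_add 1)).comp η (add_comm 1 i) :=
      (Ext.comp_assoc _ _ _ _ _ (by omega)).symm
    rw [h1]
    erw [← hnat]
    rw [Ext.comp_assoc_of_second_deg_zero]
    erw [ht]
    rw [Ext.comp_zero]

theorem IsArtinianWithFiniteSocle.ext {I : Ideal R} (X : ModuleCat.{u} R) [Module.Finite R X]
    {A : Type u} [AddCommGroup A] [Module R A] (h : IsArtinianWithFiniteSocle I A) (i : ℕ) :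
    IsArtinianWithFiniteSocle I (Ext X (ModuleCat.of R A) i) := by
  induction i generalizing X with
  | zero =>
    obtain ⟨n, p, hp⟩ := Module.Finite.exists_fin' R X
    have key : ∀ n : ℕ, IsArtinianWithFiniteSocle I (Fin n → A) := by
      intro n
      induction n with
      | zero =>
        exact h.of_injective (0 : (Fin 0 → A) →ₗ[R] A) (Function.injective_of_subsingleton _)
      | succ n ih =>
        refine IsArtinianWithFiniteSocle.of_ker (LinearMap.funLeft R A Fin.succ)
          (h.of_injective (LinearMap.proj 0 ∘ₗ (LinearMap.ker _).subtype) ?_) ih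
        intro a b hab
        refine Subtype.ext (funext fun j => ?_)
        refine Fin.cases hab (fun j => ?_) j
        exact (congrFun (LinearMap.mem_ker.mp a.2) j).trans
          (congrFun (LinearMap.mem_ker.mp b.2) j).symm
    let g : (X →ₗ[R] A) →ₗ[R] (Fin n → A) :=
      LinearMap.pi fun j => LinearMap.applyₗ (p (Pi.single j 1))
    refine (key n).of_injective (g ∘ₗ
      ((Ext.linearEquiv₀ (R := R)).trans ModuleCat.homLinearEquiv).toLinearMap) ?_
    have hg : Function.Injective g := ?_
    · rw [LinearMap.coe_comp]
      exact hg.comp (LinearEquiv.injective _)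
    intro a b hab
    have : a ∘ₗ p = b ∘ₗ p := by
      refine LinearMap.pi_ext' fun j => LinearMap.ext_ring ?_
      exact congrFun hab j
    exact LinearMap.ext fun x => by
      obtain ⟨y, rfl⟩ := hp x
      exact LinearMap.congr_fun this y
  | succ i ih =>
    obtain ⟨F, _, _, _, _, p, hp⟩ := Module.exists_finite_presentation R X
    have hS := LinearMap.shortExact_shortComplexKer hp
    -- `F` is projective, so `Ext^{i+1}(X, A)` is a quotient of `Ext^i(ker p, A)`.
    exact quotientClosed I (hS.extClass.precompOfLinear R (ModuleCat.of R A) (add_comm 1 i))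
      (precomp_extClass_surjective_of_projective_X₂ _ hS i) (ih (ModuleCat.of R (LinearMap.ker p)))

theorem IsPowTorsion.ext {I : Ideal R} (X : ModuleCat.{u} R) [Module.Finite R X]
    {T : Type u} [AddCommGroup T] [Module R T] (h : IsPowTorsion I T) (i : ℕ) :
    IsPowTorsion I (Ext X (ModuleCat.of R T) i) := fun e => by
  obtain ⟨T', hT', e', rfl⟩ := exists_fg_ext_comp_subtype X T i e
  obtain ⟨k, hk⟩ := h.exists_pow_of_fg hT'
  refine ⟨k, fun r hr => ?_⟩
  rw [← Ext.smul_comp, ext_smul_eq_zero_right r (fun y : T' => Subtype.ext (hk r hr y.1 y.2)) e',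
    Ext.zero_comp]

/-- An Artinian module `A` with `Supp A ⊆ V(I)` and `(0 :_A I)` finitely generated is
`I`-cofinite. -/
theorem IsArtinianWithFiniteSocle.isCofinite {I : Ideal R} {A : Type u} [AddCommGroup A]
    [Module R A] (h : IsArtinianWithFiniteSocle I A) (hA : IsPowTorsion I A) :
    IsCofinite I A where
  support_subset := by
    intro p hp
    obtain ⟨a, ha⟩ := Module.mem_support_iff_exists_annihilator.mp hp
    obtain ⟨k, hk⟩ := hA a
    refine Ideal.IsPrime.le_of_pow_le (n := k) fun r hr => ha ?_
    rw [Submodule.mem_annihilator_span_singleton]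
    exact hk r hr
  finite_ext i := by
    have := (h.ext (ModuleCat.of R (R ⧸ I)) i).finite
    refine Module.Finite.of_injective (LinearMap.id.codRestrict
      (Submodule.torsionBySet R (Ext (ModuleCat.of R (R ⧸ I)) (ModuleCat.of R A) i) (I : Set R))
      fun e => ?_) fun a b hab => congrArg Subtype.val hab
    rw [Submodule.mem_torsionBySet_iff]
    intro r
    refine ext_smul_eq_zero_left _ (fun x => ?_) e
    obtain ⟨y, rfl⟩ := Ideal.Quotient.mk_surjective x
    change Ideal.Quotient.mk I ((r : R) • y) = 0
    exact Ideal.Quotient.eq_zero_iff_mem.mpr (I.mul_mem_right y r.2)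

end Ext

/-! ### Generalized local cohomology: exact sequences and comparison with Ext -/

section Functoriality

open Abelian

variable {R : Type u} [CommRing R] (I : Ideal R) (M : Type u) [AddCommGroup M] [Module R M]

theorem quotPowMap_self (k : ℕ) : quotPowMap I M k k le_rfl = 𝟙 _ := by
  ext x
  rfl

theorem quotPowMap_comp {k l m : ℕ} (hkl : k ≤ l) (hlm : l ≤ m) :
    quotPowMap I M l m hlm ≫ quotPowMap I M k l hkl = quotPowMap I M k m (hkl.trans hlm) := by
  ext x
  rfl

theorem extPowMap_apply (i : ℕ) (N : Type u) [AddCommGroup N] [Module R N] (k l : ℕ) (h : k ≤ l)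
    (e : Ext (quotPow I M k) (ModuleCat.of R N) i) :
    extPowMap I i M N k l h e = (Ext.mk₀ (quotPowMap I M k l h)).comp e (zero_add i) := rfl

instance directedSystem_extPowMap (i : ℕ) (N : Type u) [AddCommGroup N] [Module R N] :
    DirectedSystem (fun k : ℕ => Ext (quotPow I M k) (ModuleCat.of R N) i)
      (fun k l h => extPowMap I i M N k l h) where
  map_self k e := by
    rw [extPowMap_apply, quotPowMap_self, Ext.mk₀_id_comp]
  map_map k l m hkl hlm e := by
    rw [extPowMap_apply, extPowMap_apply, extPowMap_apply, Ext.mk₀_comp_mk₀_assoc,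
      quotPowMap_comp]

variable {N N₁ N₂ N₃ : Type u} [AddCommGroup N] [Module R N] [AddCommGroup N₁] [Module R N₁]
  [AddCommGroup N₂] [Module R N₂] [AddCommGroup N₃] [Module R N₃]

/-- The class in `H^i_I(M, N)` of an element of `Ext^i(M / I ^ k M, N)`. -/
noncomputable abbrev ofExt (i k : ℕ) :
    Ext (quotPow I M k) (ModuleCat.of R N) i →ₗ[R] genLocalCohomology I i M N :=
  Module.DirectLimit.of R ℕ (fun k : ℕ => Ext (quotPow I M k) (ModuleCat.of R N) i)
    (extPowMap I i M N) k

theorem exists_ofExt {i : ℕ} (z : genLocalCohomology I i M N) :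
    ∃ k e, ofExt I M i k e = z :=
  Module.DirectLimit.exists_of z

theorem exists_extPowMap_eq_zero {i k : ℕ} (e : Ext (quotPow I M k) (ModuleCat.of R N) i)
    (h : ofExt I M i k e = 0) : ∃ l, ∃ hkl : k ≤ l, extPowMap I i M N k l hkl e = 0 :=
  Module.DirectLimit.of.zero_exact h

theorem ofExt_extPowMap {i k l : ℕ} (hkl : k ≤ l) (e : Ext (quotPow I M k) (ModuleCat.of R N) i) :
    ofExt I M i l (extPowMap I i M N k l hkl e) = ofExt I M i k e :=
  Module.DirectLimit.of_f

theorem extPowMap_comp {i j m : ℕ} (α : Ext (ModuleCat.of R N₁) (ModuleCat.of R N₂) j)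
    (h : i + j = m) {k l : ℕ} (hkl : k ≤ l) (e : Ext (quotPow I M k) (ModuleCat.of R N₁) i) :
    (extPowMap I i M N₁ k l hkl e).comp α h = extPowMap I m M N₂ k l hkl (e.comp α h) :=
  Ext.comp_assoc _ _ _ (zero_add i) h (by omega)

/-- The map `H^i_I(M, N₁) → H^{i + j}_I(M, N₂)` given by a class in `Ext^j(N₁, N₂)`. -/
noncomputable def compExt {i j m : ℕ} (α : Ext (ModuleCat.of R N₁) (ModuleCat.of R N₂) j)
    (h : i + j = m) : genLocalCohomology I i M N₁ →ₗ[R] genLocalCohomology I m M N₂ :=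
  Module.DirectLimit.map (fun _ => α.postcompOfLinear R _ h) fun _ _ hkl =>
    LinearMap.ext (extPowMap_comp I M α h hkl)

theorem compExt_ofExt {i j m : ℕ} (α : Ext (ModuleCat.of R N₁) (ModuleCat.of R N₂) j)
    (h : i + j = m) (k : ℕ) (e : Ext (quotPow I M k) (ModuleCat.of R N₁) i) :
    compExt I M α h (ofExt I M i k e) = ofExt I M m k (e.comp α h) :=
  Module.DirectLimit.map_apply_of _ _ _

/-- The map `H^i_I(M, N₁) → H^i_I(M, N₂)` induced by a linear map. -/
noncomputable abbrev mapRight (i : ℕ) (f : N₁ →ₗ[R] N₂) :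
    genLocalCohomology I i M N₁ →ₗ[R] genLocalCohomology I i M N₂ :=
  compExt I M (Ext.mk₀ (ModuleCat.ofHom f)) (add_zero i)

theorem mapRight_smul_id (i : ℕ) (r : R) (z : genLocalCohomology I i M N) :
    mapRight I M i (r • LinearMap.id : N →ₗ[R] N) z = r • z := by
  obtain ⟨k, e, rfl⟩ := exists_ofExt I M z
  rw [compExt_ofExt, ← map_smul, Ext.smul_eq_comp_mk₀]
  rfl

theorem mapRight_zero (i : ℕ) (z : genLocalCohomology I i M N₁) :
    mapRight I M i (0 : N₁ →ₗ[R] N₂) z = 0 := by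
  obtain ⟨k, e, rfl⟩ := exists_ofExt I M z
  have h : ModuleCat.ofHom (0 : N₁ →ₗ[R] N₂) = 0 := rfl
  rw [compExt_ofExt, h, Ext.mk₀_zero, Ext.comp_zero, map_zero]

theorem eq_zero_of_subsingleton [Subsingleton N] {i : ℕ} (z : genLocalCohomology I i M N) :
    z = 0 := by
  have h : (LinearMap.id : N →ₗ[R] N) = 0 := Subsingleton.elim _ _
  rw [← one_smul R z, ← mapRight_smul_id, one_smul, h, mapRight_zero]

section ShortExact

variable {f : N₁ →ₗ[R] N₂} {g : N₂ →ₗ[R] N₃}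

theorem shortExact_of_exact (hf : Function.Injective f) (hfg : Function.Exact f g)
    (hg : Function.Surjective g) :
    (ModuleCat.shortComplexOfCompEqZero f g hfg.linearMap_comp_eq_zero).ShortExact where
  exact := (ShortComplex.ShortExact.moduleCat_exact_iff_function_exact _).mpr hfg
  mono_f := (ModuleCat.mono_iff_injective _).mpr hf
  epi_g := (ModuleCat.epi_iff_surjective _).mpr hg

variable (hf : Function.Injective f) (hfg : Function.Exact f g) (hg : Function.Surjective g)

/-- The connecting map `H^i_I(M, N₃) → H^{i + 1}_I(M, N₁)`. -/
noncomputable def connecting (i : ℕ) :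
    genLocalCohomology I i M N₃ →ₗ[R] genLocalCohomology I (i + 1) M N₁ :=
  compExt I M (shortExact_of_exact hf hfg hg).extClass rfl

-- Exactness survives the colimit: a relation holding in the limit already holds at a later stage,
-- where the sequence for `Ext` applies.
include hf hfg hg in
theorem exists_mapRight_eq {i : ℕ} (z : genLocalCohomology I i M N₂)
    (hz : mapRight I M i g z = 0) : ∃ y, mapRight I M i f y = z := by
  obtain ⟨k, e, rfl⟩ := exists_ofExt I M z
  rw [compExt_ofExt] at hz
  obtain ⟨l, hkl, hl⟩ := exists_extPowMap_eq_zero I M _ hz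
  have h0 : (extPowMap I i M N₂ k l hkl e).comp (Ext.mk₀ (ModuleCat.ofHom g)) (add_zero i) = 0 := by
    rw [extPowMap_comp, hl]
  obtain ⟨e', he'⟩ := Ext.covariant_sequence_exact₂ _ (shortExact_of_exact hf hfg hg) _ h0
  refine ⟨ofExt I M i l e', ?_⟩
  rw [compExt_ofExt, ← ofExt_extPowMap I M hkl e]
  exact congrArg _ he'

theorem exists_connecting_eq {i : ℕ} (z : genLocalCohomology I (i + 1) M N₁)
    (hz : mapRight I M (i + 1) f z = 0) : ∃ y, connecting I M hf hfg hg i y = z := by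
  obtain ⟨k, e, rfl⟩ := exists_ofExt I M z
  rw [compExt_ofExt] at hz
  obtain ⟨l, hkl, hl⟩ := exists_extPowMap_eq_zero I M _ hz
  have h0 : (extPowMap I (i + 1) M N₁ k l hkl e).comp (Ext.mk₀ (ModuleCat.ofHom f))
      (add_zero (i + 1)) = 0 := by
    rw [extPowMap_comp, hl]
  obtain ⟨e', he'⟩ := Ext.covariant_sequence_exact₁ _ (shortExact_of_exact hf hfg hg) _ h0 rfl
  refine ⟨ofExt I M i l e', ?_⟩
  rw [connecting, compExt_ofExt, ← ofExt_extPowMap I M hkl e]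
  exact congrArg _ he'

end ShortExact

/-- Generalized local cohomology with respect to `I` is `I`-power torsion. -/
theorem isPowTorsion_genLocalCohomology (i : ℕ) :
    IsPowTorsion I (genLocalCohomology I i M N) := fun z => by
  obtain ⟨k, e, rfl⟩ := exists_ofExt I M z
  refine ⟨k, fun r hr => ?_⟩
  rw [← map_smul, ext_smul_eq_zero_left r (fun x => ?_) e, map_zero]
  obtain ⟨y, rfl⟩ := Submodule.mkQ_surjective _ x
  rw [← map_smul, Submodule.mkQ_apply, Submodule.Quotient.mk_eq_zero]
  exact Submodule.smul_mem_smul hr trivial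

/-- The comparison map `H^i_I(M, N) → Ext^i(M, N)`. -/
noncomputable def toExt (N : Type u) [AddCommGroup N] [Module R N] (i : ℕ) :
    genLocalCohomology I i M N →ₗ[R] Ext (ModuleCat.of R M) (ModuleCat.of R N) i :=
  Module.DirectLimit.lift R ℕ _ _
    (fun k => (Ext.mk₀ (ModuleCat.ofHom (I ^ k • ⊤ : Submodule R M).mkQ)).precompOfLinear R
      (ModuleCat.of R N) (zero_add i)) fun k l hkl e => by
    exact Ext.mk₀_comp_mk₀_assoc _ _ e

theorem toExt_ofExt (i k : ℕ) (e : Ext (quotPow I M k) (ModuleCat.of R N) i) :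
    toExt I M N i (ofExt I M i k e) =
      (Ext.mk₀ (ModuleCat.ofHom (I ^ k • ⊤ : Submodule R M).mkQ)).comp e (zero_add i) :=
  Module.DirectLimit.lift_of _ _ _

variable [IsNoetherianRing R] [Module.Finite R M]

theorem exists_fg_mapRight_subtype {i : ℕ} (z : genLocalCohomology I i M N) :
    ∃ N' : Submodule R N, N'.FG ∧ ∃ y, mapRight I M i N'.subtype y = z := by
  obtain ⟨k, e, rfl⟩ := exists_ofExt I M z
  obtain ⟨N', hN', e', he'⟩ := exists_fg_ext_comp_subtype _ N i e
  exact ⟨N', hN', ofExt I M i k e', by rw [compExt_ofExt, he']⟩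

/-- A class at stage `k` that dies in `Ext^{i+1}(M, N)` comes from some `η ∈ Ext^i(I ^ k M, N)`. By
`exists_pow_comp_eq_zero`, `η` restricts to zero on `I ^ (s + k) M`, so by naturality of the
extension classes the given class vanishes at stage `s + k`. -/
theorem toExt_injective (hN : IsPowTorsion I N) (i : ℕ) :
    Function.Injective (toExt I M N i) := by
  rw [injective_iff_map_eq_zero]
  intro z hz
  obtain ⟨k, e, rfl⟩ := exists_ofExt I M z
  rw [toExt_ofExt] at hz
  have hS (k : ℕ) := shortExact_of_exact (I ^ k • ⊤ : Submodule R M).injective_subtype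
    (LinearMap.exact_subtype_mkQ _) (I ^ k • ⊤ : Submodule R M).mkQ_surjective
  cases i with
  | zero =>
    obtain ⟨g, rfl⟩ := Ext.mk₀_bijective _ _ |>.2 e
    rw [Ext.mk₀_comp_mk₀, Ext.mk₀_eq_zero_iff] at hz
    have : g = 0 := by
      ext y
      exact congrArg (fun f => f.hom y) hz
    rw [this, Ext.mk₀_zero, map_zero]
  | succ i =>
    obtain ⟨η, rfl⟩ := Ext.contravariant_sequence_exact₃ (hS k) _ e hz (add_comm 1 i)
    obtain ⟨s, hs⟩ := exists_pow_comp_eq_zero I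
      (ModuleCat.of R (I ^ k • ⊤ : Submodule R M)) N hN i η
    have hle : (I ^ (s + k) • ⊤ : Submodule R M) ≤ I ^ k • ⊤ :=
      Submodule.smul_mono_left (Ideal.pow_le_pow_right (Nat.le_add_left k s))
    let φ : ModuleCat.shortComplexOfCompEqZero (I ^ (s + k) • ⊤ : Submodule R M).subtype
        (I ^ (s + k) • ⊤ : Submodule R M).mkQ (LinearMap.exact_subtype_mkQ _).linearMap_comp_eq_zero ⟶
        ModuleCat.shortComplexOfCompEqZero (I ^ k • ⊤ : Submodule R M).subtype
        (I ^ k • ⊤ : Submodule R M).mkQ (LinearMap.exact_subtype_mkQ _).linearMap_comp_eq_zero :=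
      { τ₁ := ModuleCat.ofHom (Submodule.inclusion hle)
        τ₂ := 𝟙 _
        τ₃ := quotPowMap I M k (s + k) (Nat.le_add_left k s)
        comm₁₂ := rfl
        comm₂₃ := rfl }
    have hnat := (hS (s + k)).extClass_naturality (hS k) φ
    have h0 : (Ext.mk₀ φ.τ₁).comp η (zero_add i) = 0 := by
      refine hs _ _ ?_
      rintro _ ⟨w, rfl⟩
      have hw : (w : M) ∈ (I ^ s • (⊤ : Submodule R (I ^ k • ⊤ : Submodule R M))).map
          (I ^ k • ⊤ : Submodule R M).subtype := by
        rw [Submodule.map_smul'', Submodule.map_subtype_top, ← Submodule.mul_smul, ← pow_add]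
        exact w.2
      obtain ⟨v, hv, hvw⟩ := hw
      have : v = Submodule.inclusion hle w := Subtype.ext hvw
      exact this ▸ hv
    rw [← ofExt_extPowMap I M (Nat.le_add_left k s), extPowMap_apply]
    refine Eq.trans (congrArg _ ?_) (map_zero _)
    calc _ = ((Ext.mk₀ φ.τ₃).comp (hS k).extClass (zero_add 1)).comp η (add_comm 1 i) :=
          (Ext.comp_assoc _ _ _ _ _ (by omega)).symm
      _ = (hS (s + k)).extClass.comp ((Ext.mk₀ φ.τ₁).comp η (zero_add i)) (add_comm 1 i) := by
          rw [← hnat, Ext.comp_assoc_of_second_deg_zero]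
      _ = 0 := by rw [h0, Ext.comp_zero]

theorem eq_zero_of_isPowTorsion {d : ℕ} [HasProjectiveDimensionLT (ModuleCat.of R M) (d + 1)]
    (hN : IsPowTorsion I N) {i : ℕ} (hi : d < i) (z : genLocalCohomology I i M N) : z = 0 :=
  toExt_injective I M hN i
    ((Ext.eq_zero_of_hasProjectiveDimensionLT _ (d + 1) hi).trans (map_zero _).symm)

end Functoriality

/-! ### Torsion quotients, regular elements and dimension zero -/

section Torsion

variable {R : Type u} [CommRing R] [IsNoetherianRing R] (I : Ideal R)
  (N : Type u) [AddCommGroup N] [Module R N]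

omit [IsNoetherianRing R] in
theorem isPowTorsion_gammaTorsion : IsPowTorsion I (gammaTorsion I N) := fun y => by
  obtain ⟨k, hk⟩ := y.2
  exact ⟨k, fun r hr => Subtype.ext (hk r hr)⟩

variable {I N}

/-- As `I` is finitely generated, `I y ⊆ Γ_I(N)` is killed by one power `I ^ k`, so `I ^ (k + 1)`
kills `y`. -/
theorem eq_zero_of_smul_eq_zero_quotient_gammaTorsion (z : N ⧸ gammaTorsion I N)
    (hz : ∀ r ∈ I, r • z = 0) : z = 0 := by
  obtain ⟨y, rfl⟩ := Submodule.mkQ_surjective _ z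
  let f : I →ₗ[R] gammaTorsion I N :=
    (LinearMap.toSpanSingleton R N y ∘ₗ I.subtype).codRestrict _ fun r =>
      (Submodule.Quotient.mk_eq_zero _).mp (hz r r.2)
  obtain ⟨k, hk⟩ := (isPowTorsion_gammaTorsion I N).exists_pow_of_fg (N := LinearMap.range f)
    (LinearMap.range_eq_map f ▸ Module.Finite.fg_top.map f)
  refine (Submodule.Quotient.mk_eq_zero _).mpr ⟨k + 1, fun r hr => ?_⟩
  rw [pow_succ] at hr
  induction hr using Submodule.mul_induction_on' with
  | mem_mul_mem r hr s hs =>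
    rw [mul_smul]
    exact congrArg Subtype.val (hk r hr (f ⟨s, hs⟩) ⟨_, rfl⟩)
  | add r _ s _ hr hs => rw [add_smul, hr, hs, add_zero]

/-- Prime avoidance: otherwise `I` lies in an associated prime, the annihilator of some nonzero `y`.
-/
theorem exists_isSMulRegular_mem (hN : ∀ y : N, (∀ r ∈ I, r • y = 0) → y = 0)
    (hfin : (associatedPrimes R N).Finite) : ∃ x ∈ I, IsSMulRegular N x := by
  by_contra! h
  have hsub : (I : Set R) ⊆ ⋃ p ∈ associatedPrimes R N, p := by
    intro x hx
    rw [biUnion_associatedPrimes_eq_zero_divisors]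
    have := h x hx
    rw [isSMulRegular_iff_right_eq_zero_of_smul] at this
    push Not at this
    obtain ⟨y, hy, hy0⟩ := this
    exact ⟨y, hy0, hy⟩
  obtain ⟨P, hP, hIP⟩ := (I.subset_union_prime_finite hfin (f := id) 0 0
    fun _ h _ _ ↦ h.isPrime).1 hsub
  rw [AssociatedPrimes.mem_iff, isAssociatedPrime_iff] at hP
  obtain ⟨hprime, y, rfl⟩ := hP
  have hy : y = 0 := hN y fun r hr => by simpa using! hIP hr
  exact hprime.ne_top (by simp [hy])

variable (I N) in
theorem exists_isSMulRegular_quotient_gammaTorsion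
    (hfin : (associatedPrimes R (N ⧸ gammaTorsion I N)).Finite) :
    ∃ x ∈ I, IsSMulRegular (N ⧸ gammaTorsion I N) x :=
  exists_isSMulRegular_mem eq_zero_of_smul_eq_zero_quotient_gammaTorsion hfin

theorem isPowTorsion_of_supportDim_le_zero [IsLocalRing R] (h : Module.supportDim R N ≤ 0) :
    IsPowTorsion (IsLocalRing.maximalIdeal R) N := by
  intro y
  rcases subsingleton_or_nontrivial N with _ | hnt
  · exact ⟨0, fun r _ => Subsingleton.elim _ _⟩
  have h0 : Module.supportDim R N = 0 := by
    refine le_antisymm h ?_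
    have := Module.supportDim_ne_bot_of_nontrivial R N
    obtain ⟨t, ht⟩ := WithBot.ne_bot_iff_exists.mp this
    rw [← ht]
    exact_mod_cast (zero_le : 0 ≤ t)
  have hsupp := support_of_supportDim_eq_zero R N h0
  have hrad : IsLocalRing.maximalIdeal R ≤ (Submodule.span R {y}).annihilator.radical := by
    rw [Ideal.radical_eq_sInf]
    refine le_sInf fun p ⟨hp, hprime⟩ => ?_
    have : (⟨p, hprime⟩ : PrimeSpectrum R) ∈ Module.support R N :=
      Module.mem_support_iff_exists_annihilator.mpr ⟨y, hp⟩
    rw [hsupp] at this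
    exact this
  obtain ⟨k, hk⟩ := Ideal.exists_pow_le_of_le_radical_of_fg hrad (IsNoetherian.noetherian _)
  exact ⟨k, fun r hr => (Submodule.mem_annihilator_span_singleton _ _).mp (hk hr)⟩

end Torsion

/-! ### Vanishing above the top degree, and the induction on dimension -/

section Vanishing

open scoped Pointwise

variable {R : Type u} [CommRing R] [IsNoetherianRing R] (I : Ideal R)
  (M : Type u) [AddCommGroup M] [Module R M]

omit [IsNoetherianRing R] in
/-- The kernel of multiplication by a regular element `x` on `H^{i + 1}_I(M, N)` is covered by
`H^i_I(M, N / xN)`. -/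
theorem exists_torsionBy_le_range {N : Type u} [AddCommGroup N] [Module R N] {x : R}
    (hx : IsSMulRegular N x) (i : ℕ) :
    ∃ δ : genLocalCohomology I i M (N ⧸ (x • ⊤ : Submodule R N)) →ₗ[R]
      genLocalCohomology I (i + 1) M N,
      Submodule.torsionBy R (genLocalCohomology I (i + 1) M N) x ≤ LinearMap.range δ := by
  have hex : Function.Exact (x • LinearMap.id : N →ₗ[R] N) (x • ⊤ : Submodule R N).mkQ := by
    intro y
    rw [Submodule.mkQ_apply, Submodule.Quotient.mk_eq_zero, Submodule.mem_smul_pointwise_iff_exists]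
    simp
  refine ⟨connecting I M (f := x • LinearMap.id) (fun a b hab => hx hab) hex (Submodule.mkQ_surjective _) i,
    fun z hz => exists_connecting_eq I M _ _ _ z ?_⟩
  rw [mapRight_smul_id]
  exact hz

variable {I} [Module.Finite R M] {d : ℕ} [HasProjectiveDimensionLT (ModuleCat.of R M) (d + 1)]

-- The kernel is the image of `H^i_I(M, Γ_J(N))`, which vanishes for `i > pd M` because `Γ_J(N)` is
-- `I`-power torsion.
include d in
theorem mapRight_mkQ_gammaTorsion_injective {J : Ideal R} (hIJ : I ≤ J) (N : Type u)
    [AddCommGroup N] [Module R N] {i : ℕ} (hi : d < i) :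
    Function.Injective (mapRight I M i (gammaTorsion J N).mkQ) := by
  rw [injective_iff_map_eq_zero]
  intro z hz
  obtain ⟨y, rfl⟩ := exists_mapRight_eq I M (gammaTorsion J N).injective_subtype
    (LinearMap.exact_subtype_mkQ _) (Submodule.mkQ_surjective _) z hz
  rw [eq_zero_of_isPowTorsion I M ((isPowTorsion_gammaTorsion J N).mono hIJ) hi y, map_zero]

variable [IsLocalRing R]

omit [IsNoetherianRing R] [IsLocalRing R] in
theorem supportDim_le_of_succ_eq {N N' : Type u} [AddCommGroup N] [Module R N] [AddCommGroup N']
    [Module R N'] {n : ℕ} (h : Module.supportDim R N + 1 = Module.supportDim R N')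
    (hn : Module.supportDim R N' ≤ (n + 1 : ℕ)) : Module.supportDim R N ≤ n := by
  rw [← h] at hn
  push_cast at hn
  exact ENat.WithBot.add_le_add_one_right_iff.mp hn

/-- For finitely generated `N` the regular element can be chosen in `I` itself, so it acts with
power torsion on the cohomology. Both claims can then be checked on the kernel of `x`, which is
covered by the cohomology of `Q/xQ` one degree lower. -/
theorem genLocalCohomology_vanishing_of_finite (hI : I ≤ IsLocalRing.maximalIdeal R) (n : ℕ)
    (N : Type u) [AddCommGroup N] [Module R N] [Module.Finite R N]
    (hn : Module.supportDim R N ≤ n) :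
    (∀ i, d + n < i → ∀ z : genLocalCohomology I i M N, z = 0) ∧
      IsPowTorsion (IsLocalRing.maximalIdeal R) (genLocalCohomology I (d + n) M N) := by
  induction n generalizing N with
  | zero =>
    have hN := isPowTorsion_of_supportDim_le_zero (by simpa using hn)
    exact ⟨fun i hi z => eq_zero_of_isPowTorsion I M (hN.mono hI) hi z,
      (hN.ext (ModuleCat.of R M) d).of_injective _ (toExt_injective I M (hN.mono hI) d)⟩
  | succ n ih =>
    let Q := N ⧸ gammaTorsion I N
    suffices H : (∀ i, d + (n + 1) < i → ∀ z : genLocalCohomology I i M Q, z = 0) ∧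
        IsPowTorsion (IsLocalRing.maximalIdeal R) (genLocalCohomology I (d + (n + 1)) M Q) by
      refine ⟨fun i hi z => ?_, H.2.of_injective _
        (mapRight_mkQ_gammaTorsion_injective (d := d) M le_rfl N (by omega))⟩
      refine mapRight_mkQ_gammaTorsion_injective (d := d) M le_rfl N (by omega) ?_
      rw [map_zero]
      exact H.1 i hi _
    rcases subsingleton_or_nontrivial Q with _ | _
    · exact ⟨fun i _ z => eq_zero_of_subsingleton I M z,
        fun z => ⟨0, fun r _ => by rw [eq_zero_of_subsingleton I M z, smul_zero]⟩⟩
    obtain ⟨x, hxI, hx⟩ := exists_isSMulRegular_quotient_gammaTorsion I N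
      (associatedPrimes.finite R _)
    have hdim := supportDim_le_of_succ_eq
      (Module.supportDim_quotSMulTop_succ_eq_supportDim hx (hI hxI))
      ((Module.supportDim_le_of_surjective _ (Submodule.mkQ_surjective _)).trans hn)
    obtain ⟨ih₁, ih₂⟩ := ih (QuotSMulTop x Q) hdim
    have hxtors (i : ℕ) (z : genLocalCohomology I i M Q) : ∃ k : ℕ, x ^ k • z = 0 := by
      obtain ⟨k, hk⟩ := isPowTorsion_genLocalCohomology I M i z
      exact ⟨k, hk _ (Ideal.pow_mem_pow hxI k)⟩
    refine ⟨fun i hi z => ?_, IsPowTorsion.of_torsionBy (hxtors _) fun z hz => ?_⟩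
    · obtain ⟨i, rfl⟩ : ∃ j, i = j + 1 := ⟨i - 1, by omega⟩
      obtain ⟨δ, hδ⟩ := exists_torsionBy_le_range I M hx i
      have hreg : ∀ w : genLocalCohomology I (i + 1) M Q, x • w = 0 → w = 0 := by
        intro w hw
        obtain ⟨y, rfl⟩ := hδ hw
        rw [ih₁ i (by omega) y, map_zero]
      obtain ⟨k, hk⟩ := hxtors _ z
      induction k with
      | zero => simpa using hk
      | succ k ihk => exact ihk (hreg _ (by rwa [smul_smul, ← pow_succ']))
    · obtain ⟨δ, hδ⟩ := exists_torsionBy_le_range I M hx (d + n)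
      obtain ⟨y, rfl⟩ := hδ hz
      obtain ⟨k, hk⟩ := ih₂ y
      exact ⟨k, fun r hr => by rw [← map_smul, hk r hr, map_zero]⟩

/-- `H^i_I(M, N)` vanishes for `i > pd M + dim N`, and is supported at the maximal ideal
for `i = pd M + dim N`. -/
theorem genLocalCohomology_vanishing (hI : I ≤ IsLocalRing.maximalIdeal R) (n : ℕ)
    (N : Type u) [AddCommGroup N] [Module R N] (hn : Module.supportDim R N ≤ n) :
    (∀ i, d + n < i → ∀ z : genLocalCohomology I i M N, z = 0) ∧
      IsPowTorsion (IsLocalRing.maximalIdeal R) (genLocalCohomology I (d + n) M N) := by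
  have key (N' : Submodule R N) (hN' : N'.FG) := by
    have : Module.Finite R N' := Module.Finite.iff_fg.mpr hN'
    exact genLocalCohomology_vanishing_of_finite (d := d) M hI n N'
      ((Module.supportDim_le_of_injective _ N'.injective_subtype).trans hn)
  refine ⟨fun i hi z => ?_, fun z => ?_⟩
  · obtain ⟨N', hN', y, rfl⟩ := exists_fg_mapRight_subtype I M z
    rw [(key N' hN').1 i hi y, map_zero]
  · obtain ⟨N', hN', y, rfl⟩ := exists_fg_mapRight_subtype I M z
    obtain ⟨k, hk⟩ := (key N' hN').2 y
    exact ⟨k, fun r hr => by rw [← map_smul, hk r hr, map_zero]⟩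

omit [IsNoetherianRing R] [IsLocalRing R] in
theorem finite_torsionBySet_of_finite_hom {J : Ideal R} {N : Type u} [AddCommGroup N]
    [Module R N] [Module.Finite R ((R ⧸ J) →ₗ[R] N)] :
    Module.Finite R (Submodule.torsionBySet R N (J : Set R)) := by
  refine Module.Finite.of_surjective ((LinearMap.applyₗ (1 : R ⧸ J)).codRestrict
    (Submodule.torsionBySet R N (J : Set R)) fun φ => ?_) fun t => ?_
  · rw [Submodule.mem_torsionBySet_iff]
    intro r
    have : (r : R) • (1 : R ⧸ J) = 0 := by
      rw [Algebra.smul_def, mul_one]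
      exact Ideal.Quotient.eq_zero_iff_mem.mpr r.2
    rw [LinearMap.applyₗ_apply_apply, ← map_smul, this, map_zero]
  · refine ⟨Submodule.liftQ J (LinearMap.toSpanSingleton R N t) fun r hr =>
      (Submodule.mem_torsionBySet_iff _ _).mp t.2 ⟨r, hr⟩, Subtype.ext ?_⟩
    exact one_smul R (t : N)

theorem isArtinianWithFiniteSocle_genLocalCohomology {J : Ideal R} (hIJ : I ≤ J)
    (hJ : J ≤ IsLocalRing.maximalIdeal R) {W : ModuleCat.{u} R → Prop}
    (hW : IsWeaklyFiniteClass J M W) (n : ℕ) (N : Type u) [AddCommGroup N] [Module R N]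
    (hN : W (ModuleCat.of R N)) (hn : Module.supportDim R N = n) :
    IsArtinianWithFiniteSocle J (genLocalCohomology I (d + n) M N) := by
  induction n generalizing N with
  | zero =>
    have htors := isPowTorsion_of_supportDim_le_zero (by simpa using hn.le)
    have : Module.Finite R ((R ⧸ J) →ₗ[R] N) := (hW.finite_hom _ hN).1
    have hA : IsArtinianWithFiniteSocle J N :=
      .of_isPowTorsion hJ htors finite_torsionBySet_of_finite_hom
    exact (hA.ext (ModuleCat.of R M) d).of_injective _
      (toExt_injective I M (htors.mono (hIJ.trans hJ)) d)
  | succ n ih =>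
    let Q := N ⧸ gammaTorsion J N
    have hQ : W (ModuleCat.of R Q) := hW.quot_torsion _ hN
    have hQn : Module.supportDim R Q ≤ (n + 1 : ℕ) :=
      (Module.supportDim_le_of_surjective _ (Submodule.mkQ_surjective _)).trans hn.le
    refine IsArtinianWithFiniteSocle.of_injective _
      (mapRight_mkQ_gammaTorsion_injective (d := d) M hIJ N (by omega)) ?_
    have hzero (h : ∀ z : genLocalCohomology I (d + (n + 1)) M Q, z = 0) :
        IsArtinianWithFiniteSocle J (genLocalCohomology I (d + (n + 1)) M Q) := by
      have : Subsingleton (genLocalCohomology I (d + (n + 1)) M Q) :=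
        ⟨fun a b => (h a).trans (h b).symm⟩
      exact ⟨inferInstance, inferInstance⟩
    rcases subsingleton_or_nontrivial Q with _ | hnt
    · exact hzero (eq_zero_of_subsingleton I M)
    obtain ⟨x, hxJ, hx⟩ := exists_isSMulRegular_quotient_gammaTorsion J N (hW.finite_ass _ hQ)
    obtain ⟨-, hQx, hdim⟩ := hW.quot_regular _ hQ hnt x (hJ hxJ) hx
    have hle : Module.supportDim R (Q ⧸ (x • ⊤ : Submodule R Q)) ≤ n :=
      supportDim_le_of_succ_eq hdim hQn
    -- Passing to `N/Γ_J(N)` may lower the dimension; then degree `d + n + 1` exceeds the vanishing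
    -- bound.
    rcases hle.lt_or_eq with hlt | heq
    · have hQn' : Module.supportDim R Q ≤ n := by
        rw [← hdim]
        exact ENat.WithBot.add_one_le_natCast_iff.mpr hlt
      exact hzero ((genLocalCohomology_vanishing (d := d) M (hIJ.trans hJ) n Q hQn').1 _ (by omega))
    · have hH : IsPowTorsion (IsLocalRing.maximalIdeal R) (genLocalCohomology I (d + (n + 1)) M Q) :=
        (genLocalCohomology_vanishing (d := d) M (hIJ.trans hJ) (n + 1) Q hQn).2
      obtain ⟨δ, hδ⟩ := exists_torsionBy_le_range I M hx (d + n)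
      have hker : IsArtinianWithFiniteSocle J
          (Submodule.torsionBy R (genLocalCohomology I (d + (n + 1)) M Q) x) :=
        (quotientClosed J δ.rangeRestrict δ.surjective_rangeRestrict (ih _ hQx heq)).of_injective
          (Submodule.inclusion hδ) (Submodule.inclusion_injective hδ)
      have := hker.isArtinian
      have : IsArtinian R (genLocalCohomology I (d + (n + 1)) M Q) := by
        refine isArtinian_of_isArtinian_torsionBy x fun z => ?_
        obtain ⟨k, hk⟩ := hH z
        exact ⟨k, hk _ (Ideal.pow_mem_pow (hJ hxJ) k)⟩
      exact .of_torsionBy hxJ le_rfl hker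

end Vanishing

end GenLocalCohomology

theorem theorem2p14 {R : Type u} [CommRing R] [IsLocalRing R] [IsNoetherianRing R]
    (a b : Ideal R) (hab : a ≤ b) (hb : b ≠ ⊤)
    (M : Type u) [AddCommGroup M] [Module R M] [Module.Finite R M]
    (N : Type u) [AddCommGroup N] [Module R N]
    (d : ℕ) (hd : projectiveDimension (ModuleCat.of R M) = d)
    (hN : GenLocalCohomology.IsWeaklyFinite b M N)
    (n : ℕ) (hn : Module.supportDim R N = n) :
    IsArtinian R (GenLocalCohomology.genLocalCohomology a (d + n) M N) ∧
      GenLocalCohomology.IsCofinite b (GenLocalCohomology.genLocalCohomology a (d + n) M N) ∧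
      (a = b →
        GenLocalCohomology.IsCofinite a
          (GenLocalCohomology.genLocalCohomology a (d + n) M N)) := by
  obtain ⟨W, hW, hWN⟩ := hN
  have hbm : b ≤ IsLocalRing.maximalIdeal R := IsLocalRing.le_maximalIdeal hb
  have : HasProjectiveDimensionLT (ModuleCat.of R M) (d + 1) :=
    (projectiveDimension_le_iff _ d).mp hd.le
  have hH := GenLocalCohomology.isArtinianWithFiniteSocle_genLocalCohomology (d := d) M hab hbm
    hW n N hWN hn
  -- The top module is `m`-power torsion, hence `b`-power torsion, which gives the support
  -- condition; being `a`-power torsion would not suffice.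
  have hcof := hH.isCofinite
    ((GenLocalCohomology.genLocalCohomology_vanishing (d := d) M (hab.trans hbm) n N hn.le).2.mono
      hbm)
  exact ⟨hH.isArtinian, hcof, fun h => by subst h; exact hcof⟩
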